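/- Let $1\le N\le N_R$ be integers (in the application $N=N_R-N_T+1$ with $1\le N_T\le N_R$). Put $A_n(\sigma)=\frac{(N)_n}{(N_R)_n}\frac{\sigma^n}{n!}$, where $(x)_n=x(x+1)\cdots(x+n-1)$, and ${}_1F_1(N;N_R;\sigma)=\sum_{n\ge0}A_n(\sigma)$. Let $$M(s,a)=\frac{1}{(1-s)^N}\,{}_1F_1\!\Big(N;N_R;\frac{as}{1-s}\Big)\quad(s<1),\qquad p(t,a)=\sum_{n=0}^\infty A_n(a)\sum_{m=0}^n\binom nm\frac{(-1)^m t^{N+n-m-1}e^{-t}}{(N+n-m-1)!}.$$ For every $a\ge 0$, $p(\cdot,a)$ is non-negative and $C^\infty$ on $(0,\infty)$, and it is the density, supported on $(0,\infty)$, of the unique probability law on $\mathbb R$ whose moment generating function is $M(s,a)$ for $s<1$. Write $p^{(l)}=\partial_t^l p$ and $\mathbf p=(p,p^{(1)},p^{(2)})^{T}$. Then for all $t>0$ and $a>0$, $\mathbf p(t,\cdot)$ is differentiable at $a$ and $$\partial_a\mathbf p(t,a)=\frac1a\,\mathbf Q(t,a)\,\mathbf p(t,a),$$ where the $3\times3$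 matrix $\mathbf Q(t,a)$ has first row $(-1,\;N-t-2,\;-t)$ and remaining entries \begin{align*} Q_{21}&=2-N_R+\frac{2-2N-N_R-a+NN_R+Na}{t},\\ Q_{22}&=4-2N-N_R-a+t+\frac{2+N^2-3N}{t},\\ Q_{23}&=1-N+t,\\ Q_{31}&=-2+N_R+\frac{-4+4N+2N_R+a-2NN_R-Na}{t}\\ &\quad+\frac{-4+6N+2N_R+2a-3NN_R-3Na+N^2N_R+N^2a-2N^2}{t^2},\\ Q_{32}&=3N-4+a-t+\frac{-6-3N^2+9N}{t}+\frac{-4+8N-5N^2+N^3}{t^2},\\ Q_{33}&=-1+2N-N_R-a-t+\frac{-2-N^2+3N}{t}. \end{align*} In particular $a\,\partial_a p=-p+(N-t-2)\,p^{(1)}-t\,p^{(2)}$; moreover $a\,\partial_a p^{(1)}=-t\,p^{(3)}+(N-t-3)\,p^{(2)}-2\,p^{(1)}$. -/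

import Mathlib

open MeasureTheory ProbabilityTheory Set
open scoped Nat ContDiff Matrix

noncomputable section

namespace ZFSnr

/-- The coefficient `A_n(σ) = (N)_n / (N_R)_n * σ^n / n!`, with `(x)_n` the rising factorial. -/
def coeffA (N NR n : ℕ) (σ : ℝ) : ℝ :=
  (N.ascFactorial n : ℝ) / (NR.ascFactorial n : ℝ) * (σ ^ n / (n ! : ℝ))

/-- The confluent hypergeometric function `₁F₁(N; N_R; σ)`. -/
def hyp1F1 (N NR : ℕ) (σ : ℝ) : ℝ := ∑' n : ℕ, coeffA N NR n σ

/-- The (normalized) SNR moment generating function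
`M(s, a) = (1 - s)^(-N) * ₁F₁(N; N_R; a s / (1 - s))`, meant for `s < 1`. -/
def snrMgf (N NR : ℕ) (s a : ℝ) : ℝ :=
  1 / (1 - s) ^ N * hyp1F1 N NR (a * s / (1 - s))

/-- The (normalized) SNR density `p(t, a)`, as an infinite series. For `1 ≤ N` and `m ≤ n` the
exponent `N + n - m - 1` involves no truncated subtraction. -/
def snrPdf (N NR : ℕ) (t a : ℝ) : ℝ :=
  ∑' n : ℕ, coeffA N NR n a *
    ∑ m ∈ Finset.range (n + 1), (n.choose m : ℝ) *
      ((-1) ^ m * t ^ (N + n - m - 1) * Real.exp (-t) / ((N + n - m - 1)! : ℝ))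

/-- The measure on `ℝ` with density `t ↦ p(t, a)` on `(0, ∞)`. -/
def snrMeasure (N NR : ℕ) (a : ℝ) : Measure ℝ :=
  (volume.restrict (Ioi 0)).withDensity fun t => ENNReal.ofReal (snrPdf N NR t a)

/-- `ν` is a probability law on `ℝ` with moment generating function `M(·, a)` on `s < 1`. -/
def HasSnrMgf (N NR : ℕ) (a : ℝ) (ν : Measure ℝ) : Prop :=
  IsProbabilityMeasure ν ∧
    ∀ s : ℝ, s < 1 → Integrable (fun x => Real.exp (s * x)) ν ∧ mgf id ν s = snrMgf N NR s a

/-- `p^{(l)}(t, a)`, the `l`-th partial derivative of `p` with respect to `t`. -/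
def snrPdfDeriv (N NR l : ℕ) (t a : ℝ) : ℝ :=
  iteratedDeriv l (fun τ => snrPdf N NR τ a) t

/-- The vector `(p, p^{(1)}, p^{(2)})` at `(t, a)`. -/
def snrVec (N NR : ℕ) (t a : ℝ) : Fin 3 → ℝ :=
  ![snrPdf N NR t a, snrPdfDeriv N NR 1 t a, snrPdfDeriv N NR 2 t a]

/-- The matrix `Q(t, a)`; the parameters `N` and `R = N_R` are taken in `ℝ`. -/
def matQ (N R t a : ℝ) : Matrix (Fin 3) (Fin 3) ℝ :=
  !![-1, N - t - 2, -t;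
     2 - R + (2 - 2 * N - R - a + N * R + N * a) / t,
     4 - 2 * N - R - a + t + (2 + N ^ 2 - 3 * N) / t,
     1 - N + t;
     -2 + R + (-4 + 4 * N + 2 * R + a - 2 * N * R - N * a) / t
       + (-4 + 6 * N + 2 * R + 2 * a - 3 * N * R - 3 * N * a) / t ^ 2
       + (N ^ 2 * R + N ^ 2 * a - 2 * N ^ 2) / t ^ 2,
     3 * N - 4 + a - t + (-6 - 3 * N ^ 2 + 9 * N) / t
       + (-4 + 8 * N - 5 * N ^ 2 + N ^ 3) / t ^ 2,
     -1 + 2 * N - R - a - t + (-2 - N ^ 2 + 3 * N) / t]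

end ZFSnr

end

/-! Let Δ be the forward difference in the index of the Erlang density `erl`. Then p is the sum of
A_n(a) Δⁿ `erl` N, and the Laplace transform of Δⁿ `erl` N is (1-s)^(-N) (s/(1-s))ⁿ; summing gives
M. The factorial decay of A_n beats every geometric bound, so all termwise operations are
legitimate.

The operator a ∂_a multiplies the n-th term by n, and n is an eigenvalue of a Laguerre operator in t
(`erlDiff_laguerre`), so a ∂_a becomes a second-order operator in t. The recursion for A_n gives a
third-order equation in t (`pdfSer_ode`); it and its derivative eliminate p⁽³⁾ and p⁽⁴⁾, which
closes the system.

For positivity, (N)_n/(N_R)_n is the n-th moment of a beta variable U. With S = 1 + Δ, the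
coefficient of a^j/j! in e^a p is E[(1 - U + US)^j] applied to `erl` N, which is non-negative.
Uniqueness follows by analytic continuation of the moment generating function. -/

noncomputable section

namespace ZFSnr

/-! ### Erlang densities and their index differences -/

/-- The Erlang density `t ^ (k - 1) e ^ (-t) / (k - 1)!` for `k ≥ 1`, extended by `0` to `k ≤ 0`. -/
def erl : ℤ → ℝ → ℝ
  | Int.ofNat 0, _ => 0
  | Int.ofNat (k + 1), t => t ^ k * Real.exp (-t) / (k ! : ℝ)
  | Int.negSucc _, _ => 0

/-- The `n`-th forward difference of `erl` in its index. -/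
def erlDiff : ℤ → ℕ → ℝ → ℝ
  | N, 0, t => erl N t
  | N, n + 1, t => erlDiff (N + 1) n t - erlDiff N n t

theorem erl_natCast_add_one (k : ℕ) (t : ℝ) :
    erl ((k : ℤ) + 1) t = t ^ k * Real.exp (-t) / (k ! : ℝ) := rfl

theorem erl_of_nonpos {k : ℤ} (hk : k ≤ 0) (t : ℝ) : erl k t = 0 := by
  match k, hk with
  | Int.ofNat 0, _ => rfl
  | Int.ofNat (k + 1), h => exact absurd h (by simp only [Int.ofNat_eq_natCast]; omega)
  | Int.negSucc _, _ => rfl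

/-- Case split of an integer index into the vanishing and the genuine range of `erl`. -/
theorem nonpos_or_eq_natCast_add_one (k : ℤ) : k ≤ 0 ∨ ∃ j : ℕ, k = (j : ℤ) + 1 := by
  rcases le_or_gt k 0 with h | h
  · exact Or.inl h
  · exact Or.inr ⟨(k - 1).toNat, by omega⟩

theorem erlDiff_zero (N : ℤ) (t : ℝ) : erlDiff N 0 t = erl N t := rfl

theorem erlDiff_succ (N : ℤ) (n : ℕ) (t : ℝ) :
    erlDiff N (n + 1) t = erlDiff (N + 1) n t - erlDiff N n t := rfl

theorem mul_erl (k : ℤ) (t : ℝ) : t * erl k t = k * erl (k + 1) t := by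
  rcases nonpos_or_eq_natCast_add_one k with h | ⟨j, rfl⟩
  · rw [erl_of_nonpos h]
    rcases h.eq_or_lt with rfl | h
    · simp
    · rw [erl_of_nonpos (by omega)]; simp
  · have := erl_natCast_add_one (j + 1) t
    push_cast at this
    rw [this, erl_natCast_add_one, Nat.factorial_succ]
    push_cast
    field_simp
    ring

/-- Extension by zero makes the recursion valid at `k = 1` too; integer indices are needed because
repeated differentiation lowers the index below 1. -/
theorem hasDerivAt_erl (k : ℤ) (t : ℝ) : HasDerivAt (erl k) (erl (k - 1) t - erl k t) t := by
  rcases nonpos_or_eq_natCast_add_one k with h | ⟨j, rfl⟩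
  · have : erl k = fun _ => 0 := funext (erl_of_nonpos h)
    rw [this, erl_of_nonpos (by omega)]
    simpa using hasDerivAt_const t (0 : ℝ)
  · have h1 : HasDerivAt (erl ((j : ℤ) + 1))
        (((j : ℝ) * t ^ (j - 1) * Real.exp (-t) + t ^ j * (Real.exp (-t) * -1)) / (j ! : ℝ)) t :=
      ((hasDerivAt_pow j t).mul ((hasDerivAt_neg t).exp)).div_const _
    convert h1 using 1
    rcases j with _ | j
    · simp [erl]
    · rw [erl_natCast_add_one]
      have := erl_natCast_add_one j t
      push_cast
      rw [add_sub_cancel_right, this, Nat.factorial_succ]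
      push_cast
      field_simp
      ring

theorem abs_erl_le (k : ℤ) (t : ℝ) : |erl k t| ≤ Real.exp (2 * |t|) := by
  rcases nonpos_or_eq_natCast_add_one k with h | ⟨j, rfl⟩
  · rw [erl_of_nonpos h]; simp [Real.exp_nonneg]
  · rw [erl_natCast_add_one, mul_div_right_comm, abs_mul, abs_div, abs_pow, Real.abs_exp,
      Nat.abs_cast, two_mul, Real.exp_add]
    gcongr
    · exact Real.pow_div_factorial_le_exp _ (abs_nonneg t) j
    · exact neg_le_abs t

theorem erl_nonneg (k : ℤ) {t : ℝ} (ht : 0 ≤ t) : 0 ≤ erl k t := by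
  rcases nonpos_or_eq_natCast_add_one k with h | ⟨j, rfl⟩
  · rw [erl_of_nonpos h]
  · rw [erl_natCast_add_one]; positivity

/-- Leibniz rule for differences applied to the linear weight in `mul_erl`. At `n = 0` the truncated
`n - 1` is harmless, its coefficient being zero. -/
theorem mul_erlDiff (N : ℤ) (n : ℕ) (t : ℝ) :
    t * erlDiff N n t = (N + n) * erlDiff (N + 1) n t + n * erlDiff (N + 1) (n - 1) t := by
  induction n generalizing N with
  | zero => simpa [erlDiff_zero] using mul_erl N t
  | succ n ih =>
    have h1 := ih N
    have h2 := ih (N + 1)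
    have h3 := erlDiff_succ (N + 1) n t
    rw [erlDiff_succ, mul_sub, h1, h2]
    rcases n with _ | n
    · simp at *
      linear_combination (-(N : ℝ) - 1) * h3
    · have h4 := erlDiff_succ (N + 1) n t
      simp only [Nat.add_sub_cancel]
      push_cast
      linear_combination (-(N : ℝ) - n - 2) * h3 - (n + 1 : ℝ) * h4

theorem hasDerivAt_erlDiff (N : ℤ) (n : ℕ) (t : ℝ) :
    HasDerivAt (erlDiff N n) (-erlDiff (N - 1) (n + 1) t) t := by
  induction n generalizing N with
  | zero =>
    refine (hasDerivAt_erl N t).congr_deriv ?_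
    simp [erlDiff_succ, erlDiff_zero]
  | succ n ih =>
    refine ((ih (N + 1)).sub (ih N)).congr_deriv ?_
    rw [erlDiff_succ (N - 1) (n + 1), add_sub_cancel_right, sub_add_cancel]
    ring

theorem abs_erlDiff_le (N : ℤ) (n : ℕ) (t : ℝ) :
    |erlDiff N n t| ≤ 2 ^ n * Real.exp (2 * |t|) := by
  induction n generalizing N with
  | zero => simpa [erlDiff_zero] using abs_erl_le N t
  | succ n ih =>
    rw [erlDiff_succ]
    refine (abs_sub _ _).trans ?_
    have := ih N
    have := ih (N + 1)
    rw [pow_succ]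
    linarith

/-- The binomial expansion of `erlDiff`. -/
theorem erlDiff_eq_sum (N : ℤ) (n : ℕ) (t : ℝ) :
    erlDiff N n t =
      ∑ m ∈ Finset.range (n + 1), (n.choose m : ℝ) * ((-1) ^ m * erl (N + n - m) t) := by
  induction n generalizing N with
  | zero => simp [erlDiff_zero]
  | succ n ih =>
    rw [erlDiff_succ, ih, ih, Finset.sum_range_succ' _ (n + 1)]
    simp only [Nat.choose_succ_succ, Nat.cast_add, add_mul, Finset.sum_add_distrib]
    rw [Finset.sum_range_succ (fun m => (n.choose (m + 1) : ℝ) * _) n]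
    rw [Finset.sum_range_succ' _ n]
    simp only [Nat.choose_succ_self, Nat.cast_zero, zero_mul, add_zero]
    have e1 : ∀ m : ℕ, N + 1 + (n : ℤ) - ((m + 1 : ℕ) : ℤ) = N + (n + 1 : ℕ) - (m + 1 : ℕ) := by
      intro m; push_cast; ring
    have e2 : ∀ m : ℕ, N + (n : ℤ) - (m : ℤ) = N + (n + 1 : ℕ) - (m + 1 : ℕ) := by
      intro m; push_cast; ring
    simp only [e1]
    simp only [e2]
    simp only [pow_succ, mul_neg, neg_mul, mul_one, Finset.sum_neg_distrib]
    simp only [Nat.choose_zero_right, pow_zero, Nat.cast_add, Nat.cast_one, sub_zero,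
      one_mul, add_right_comm N 1, add_assoc N]
    ring

/-- The second-order differential equation of Laguerre type satisfied by `erlDiff N n`. -/
theorem erlDiff_laguerre (N : ℤ) (n : ℕ) (t : ℝ) :
    n * erlDiff N n t = -erlDiff N n t + ((N : ℝ) - t - 2) * -erlDiff (N - 1) (n + 1) t
      - t * erlDiff (N - 2) (n + 2) t := by
  have h1 := mul_erlDiff (N - 1) (n + 1) t
  have h2 := mul_erlDiff (N - 2) (n + 2) t
  have h3 := erlDiff_succ (N - 1) (n + 1) t
  have e : N - 2 + 1 = N - 1 := by ring
  rw [e] at h2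
  rw [sub_add_cancel] at h1 h3
  simp only [Nat.add_sub_cancel] at h1
  have e' : n + 2 - 1 = n + 1 := rfl
  rw [e'] at h2
  push_cast at h1 h2
  linear_combination (-1 : ℝ) * h1 + h2 + (N + n : ℝ) * h3

/-! ### Bounds on the coefficients and differentiation in `a` -/

theorem abs_coeffA_le {N NR : ℕ} (hNR : N ≤ NR) (n : ℕ) (a : ℝ) :
    |coeffA N NR n a| ≤ |a| ^ n / (n ! : ℝ) := by
  have h : (N.ascFactorial n : ℝ) / (NR.ascFactorial n : ℝ) ≤ 1 :=
    div_le_one_of_le₀ (by exact_mod_cast Nat.ascFactorial_le n hNR) (Nat.cast_nonneg _)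
  rw [coeffA, abs_mul, abs_of_nonneg (by positivity), abs_div, abs_pow, Nat.abs_cast]
  exact mul_le_of_le_one_left (by positivity) h

theorem coeffA_succ {N NR : ℕ} (hN : 1 ≤ N) (hNR : N ≤ NR) (n : ℕ) (a : ℝ) :
    coeffA N NR (n + 1) a * ((n + 1) * (NR + n)) = a * coeffA N NR n a * (N + n) := by
  have hpos : (NR.ascFactorial n : ℝ) ≠ 0 := by
    obtain ⟨M, rfl⟩ : ∃ M, NR = M + 1 := ⟨NR - 1, by omega⟩
    exact_mod_cast (Nat.ascFactorial_pos M n).ne'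
  have hR : (NR : ℝ) + n ≠ 0 := by
    have : (1 : ℝ) ≤ NR := by exact_mod_cast hN.trans hNR
    positivity
  simp only [coeffA, Nat.ascFactorial_succ, Nat.factorial_succ, Nat.cast_mul, Nat.cast_add,
    Nat.cast_one, pow_succ]
  field_simp

theorem summable_coeffA_mul {N NR : ℕ} (hNR : N ≤ NR) (a : ℝ) {u : ℕ → ℝ} {C K : ℝ}
    (hu : ∀ n, |u n| ≤ C * K ^ n) : Summable fun n => coeffA N NR n a * u n := by
  refine Summable.of_norm_bounded
    (g := fun n => C * ((|a| * K) ^ n / (n ! : ℝ))) ((Real.summable_pow_div_factorial _).mul_left C)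
    fun n => ?_
  rw [Real.norm_eq_abs, abs_mul]
  calc |coeffA N NR n a| * |u n| ≤ |a| ^ n / (n ! : ℝ) * (C * K ^ n) :=
        mul_le_mul (abs_coeffA_le hNR n a) (hu n) (abs_nonneg _) (by positivity)
    _ = C * ((|a| * K) ^ n / (n ! : ℝ)) := by rw [mul_pow]; ring

theorem natCast_mul_abs_le {u : ℕ → ℝ} {C K : ℝ} (hu : ∀ n, |u n| ≤ C * K ^ n) (n : ℕ) :
    |(n : ℝ) * u n| ≤ C * (2 * K) ^ n := by
  have h2 : (n : ℝ) ≤ 2 ^ n := by exact_mod_cast Nat.lt_two_pow_self.le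
  rw [abs_mul, Nat.abs_cast]
  calc (n : ℝ) * |u n| ≤ 2 ^ n * (C * K ^ n) := mul_le_mul h2 (hu n) (abs_nonneg _) (by positivity)
    _ = C * (2 * K) ^ n := by rw [mul_pow]; ring

theorem hasDerivAt_coeffA (N NR n : ℕ) (a : ℝ) :
    HasDerivAt (coeffA N NR n) ((N.ascFactorial n : ℝ) / (NR.ascFactorial n : ℝ) *
      (n * a ^ (n - 1) / (n ! : ℝ))) a :=
  ((hasDerivAt_pow n a).div_const _).const_mul _

/-- Termwise differentiation in `a` of a series `∑ A_n(a) u_n`. -/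
theorem hasDerivAt_tsum_coeffA_mul {N NR : ℕ} (hNR : N ≤ NR) {a : ℝ} (ha : a ≠ 0)
    {u : ℕ → ℝ} {C K : ℝ} (hu : ∀ n, |u n| ≤ C * K ^ n) :
    HasDerivAt (fun b => ∑' n, coeffA N NR n b * u n)
      (1 / a * ∑' n, coeffA N NR n a * (n * u n)) a := by
  -- The radius is at least 1, so that `|y| ^ (n - 1) ≤ R ^ n` even when `n - 1` truncates.
  set R : ℝ := |a| + 1 with hR
  have hR1 : 1 ≤ R := by have := abs_nonneg a; linarith
  have hmem : a ∈ Metric.ball (0 : ℝ) R := by simp [hR]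
  have key := hasDerivAt_tsum_of_isPreconnected
    (g := fun n b => coeffA N NR n b * u n)
    (g' := fun n b => (N.ascFactorial n : ℝ) / (NR.ascFactorial n : ℝ) *
      (n * b ^ (n - 1) / (n ! : ℝ)) * u n)
    (u := fun n => C * ((2 * R * K) ^ n / (n ! : ℝ))) (t := Metric.ball 0 R) (y₀ := a) (y := a)
    ((Real.summable_pow_div_factorial _).mul_left C) Metric.isOpen_ball
    (convex_ball 0 R).isPreconnected
    (fun n y _ => (hasDerivAt_coeffA N NR n y).mul_const _) (fun n y hy => ?_) hmem
    (summable_coeffA_mul hNR a hu) hmem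
  · refine key.congr_deriv ?_
    rw [← tsum_mul_left]
    refine tsum_congr fun n => ?_
    rcases n with _ | n
    · simp
    · simp only [coeffA, Nat.add_sub_cancel, pow_succ]
      field_simp
  · have h : (N.ascFactorial n : ℝ) / (NR.ascFactorial n : ℝ) ≤ 1 :=
      div_le_one_of_le₀ (by exact_mod_cast Nat.ascFactorial_le n hNR) (Nat.cast_nonneg _)
    have hy' : |y| ≤ R := (mem_ball_zero_iff.mp hy).le
    have h2 : (n : ℝ) ≤ 2 ^ n := by exact_mod_cast Nat.lt_two_pow_self.le
    have h3 : |y| ^ (n - 1) ≤ R ^ n :=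
      (pow_le_pow_left₀ (abs_nonneg y) hy' _).trans (pow_le_pow_right₀ hR1 (Nat.sub_le n 1))
    rw [Real.norm_eq_abs, abs_mul, abs_mul, abs_of_nonneg (by positivity), abs_div, abs_mul,
      abs_pow, Nat.abs_cast, Nat.abs_cast]
    calc (N.ascFactorial n : ℝ) / (NR.ascFactorial n : ℝ) * (n * |y| ^ (n - 1) / (n ! : ℝ)) * |u n|
        ≤ 1 * (2 ^ n * R ^ n / (n ! : ℝ)) * (C * K ^ n) := by
          have := hu n
          gcongr
      _ = C * ((2 * R * K) ^ n / (n ! : ℝ)) := by rw [mul_pow, mul_pow]; ring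

/-! ### The density as a smooth series in `t` -/

/-- The series for the `l`-th `t`-derivative of `p`. -/
def pdfSer (N NR l : ℕ) (t a : ℝ) : ℝ :=
  ∑' n, coeffA N NR n a * ((-1) ^ l * erlDiff ((N : ℤ) - l) (n + l) t)

theorem abs_term_le (N l : ℕ) (t : ℝ) (n : ℕ) :
    |(-1) ^ l * erlDiff ((N : ℤ) - l) (n + l) t| ≤ 2 ^ l * Real.exp (2 * |t|) * 2 ^ n := by
  rw [abs_mul, abs_pow, abs_neg, abs_one, one_pow, one_mul]
  refine (abs_erlDiff_le _ _ _).trans_eq ?_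
  rw [pow_add]; ring

theorem snrPdf_eq_pdfSer {N NR : ℕ} (hN : 1 ≤ N) (t a : ℝ) :
    snrPdf N NR t a = pdfSer N NR 0 t a := by
  refine tsum_congr fun n => ?_
  congr 1
  simp only [pow_zero, one_mul, Nat.cast_zero, sub_zero, add_zero]
  rw [erlDiff_eq_sum]
  refine Finset.sum_congr rfl fun m hm => ?_
  have hm' : m ≤ n := Nat.lt_succ_iff.mp (Finset.mem_range.mp hm)
  have e : (N : ℤ) + n - m = ((N + n - m - 1 : ℕ) : ℤ) + 1 := by omega
  rw [e, erl_natCast_add_one]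
  ring

theorem hasDerivAt_pdfSer {N NR : ℕ} (hNR : N ≤ NR) (l : ℕ) (t a : ℝ) :
    HasDerivAt (fun τ => pdfSer N NR l τ a) (pdfSer N NR (l + 1) t a) t := by
  set R : ℝ := |t| + 1 with hR
  have hmem : t ∈ Metric.ball (0 : ℝ) R := by simp [hR]
  refine hasDerivAt_tsum_of_isPreconnected
    (g := fun n τ => coeffA N NR n a * ((-1) ^ l * erlDiff ((N : ℤ) - l) (n + l) τ))
    (g' := fun n τ => coeffA N NR n a *
      ((-1) ^ (l + 1) * erlDiff ((N : ℤ) - (l + 1 : ℕ)) (n + (l + 1)) τ))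
    (u := fun n => |coeffA N NR n a * (2 ^ (l + 1) * Real.exp (2 * R) * 2 ^ n)|)
    (t := Metric.ball 0 R) (y₀ := t) (y := t) ?_ Metric.isOpen_ball
    (convex_ball 0 R).isPreconnected (fun n y _ => ?_) (fun n y hy => ?_) hmem
    (summable_coeffA_mul hNR a (abs_term_le N l t)) hmem
  · exact (summable_coeffA_mul hNR a (C := 2 ^ (l + 1) * Real.exp (2 * R)) (K := 2)
      fun n => (abs_of_nonneg (by positivity)).le).abs
  · refine (((hasDerivAt_erlDiff _ _ y).const_mul _).const_mul _).congr_deriv ?_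
    rw [pow_succ, Nat.cast_add, Nat.cast_one, sub_sub, add_assoc n]
    ring
  · have hy' : |y| ≤ R := (mem_ball_zero_iff.mp hy).le
    rw [Real.norm_eq_abs, abs_mul, abs_mul (coeffA N NR n a)]
    refine mul_le_mul_of_nonneg_left ((abs_term_le N (l + 1) y n).trans ?_) (abs_nonneg _)
    refine le_trans ?_ (le_abs_self _)
    gcongr

theorem iteratedDeriv_pdfSer {N NR : ℕ} (hNR : N ≤ NR) (l : ℕ) (a : ℝ) :
    iteratedDeriv l (fun τ => pdfSer N NR 0 τ a) = fun t => pdfSer N NR l t a := by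
  induction l with
  | zero => exact iteratedDeriv_zero
  | succ l ih =>
    rw [iteratedDeriv_succ, ih]
    exact funext fun t => (hasDerivAt_pdfSer hNR l t a).deriv

theorem contDiff_snrPdf {N NR : ℕ} (hN : 1 ≤ N) (hNR : N ≤ NR) (a : ℝ) :
    ContDiff ℝ ∞ fun t => snrPdf N NR t a := by
  simp only [snrPdf_eq_pdfSer hN]
  refine contDiff_of_differentiable_iteratedDeriv fun m _ => ?_
  rw [iteratedDeriv_pdfSer hNR]
  exact fun t => (hasDerivAt_pdfSer hNR m t a).differentiableAt

theorem snrPdfDeriv_eq_pdfSer {N NR : ℕ} (hN : 1 ≤ N) (hNR : N ≤ NR) (l : ℕ) (t a : ℝ) :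
    snrPdfDeriv N NR l t a = pdfSer N NR l t a := by
  simp only [snrPdfDeriv, snrPdf_eq_pdfSer hN]
  rw [iteratedDeriv_pdfSer hNR]

theorem summable_pdfSer {N NR : ℕ} (hNR : N ≤ NR) (l : ℕ) (t a : ℝ) :
    Summable fun n => coeffA N NR n a * ((-1) ^ l * erlDiff ((N : ℤ) - l) (n + l) t) :=
  summable_coeffA_mul hNR a (abs_term_le N l t)

/-- The action of `a ∂/∂a` on the series, expressed by `t`-derivatives. -/
theorem hasSum_natCast_mul {N NR : ℕ} (hNR : N ≤ NR) (l : ℕ) (t a : ℝ) :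
    HasSum (fun n : ℕ => coeffA N NR n a * (n * ((-1) ^ l * erlDiff ((N : ℤ) - l) (n + l) t)))
      (-(l + 1) * pdfSer N NR l t a + ((N : ℝ) - l - 2 - t) * pdfSer N NR (l + 1) t a
        - t * pdfSer N NR (l + 2) t a) := by
  have h0 := (summable_pdfSer hNR l t a).hasSum
  have h1 := (summable_pdfSer hNR (l + 1) t a).hasSum
  have h2 := (summable_pdfSer hNR (l + 2) t a).hasSum
  refine (congrArg (HasSum · _) (funext fun n => ?_)).mpr
    (((h0.mul_left (-(l + 1 : ℝ))).add (h1.mul_left ((N : ℝ) - l - 2 - t))).sub (h2.mul_left t))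
  have key := erlDiff_laguerre ((N : ℤ) - l) (n + l) t
  rw [sub_sub (N : ℤ), sub_sub (N : ℤ), add_assoc n, add_assoc n] at key
  push_cast at key ⊢
  rw [pow_add, pow_add]
  linear_combination coeffA N NR n a * (-1) ^ l * key

theorem hasDerivAt_pdfSer_param {N NR : ℕ} (hNR : N ≤ NR) (l : ℕ) (t : ℝ) {a : ℝ}
    (ha : a ≠ 0) :
    HasDerivAt (fun b => pdfSer N NR l t b)
      (1 / a * (-(l + 1) * pdfSer N NR l t a + ((N : ℝ) - l - 2 - t) * pdfSer N NR (l + 1) t a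
        - t * pdfSer N NR (l + 2) t a)) a := by
  rw [← (hasSum_natCast_mul hNR l t a).tsum_eq]
  exact hasDerivAt_tsum_coeffA_mul hNR ha (abs_term_le N l t)

/-! ### The third-order equation in `t` -/

/-- The contiguity relations that link `A_{n+1}` and `A_n`, summed up. -/
theorem pdfSer_contiguous {N NR : ℕ} (hN : 1 ≤ N) (hNR : N ≤ NR) (t a : ℝ) :
    ∑' n : ℕ, coeffA N NR n a * ((n + NR - 1) * (n * erlDiff ((N : ℤ) + 1) (n - 1) t)) =
      a * ∑' n : ℕ, coeffA N NR n a * ((N + n) * erlDiff ((N : ℤ) + 1) n t) := by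
  -- The term `n = 0` carries a factor `n` and drops out; after the shift `coeffA_succ` matches the
  -- series term by term.
  rw [tsum_eq_zero_add', ← tsum_mul_left]
  · simp only [CharP.cast_eq_zero, zero_mul, mul_zero, zero_add]
    refine tsum_congr fun n => ?_
    have := coeffA_succ hN hNR n a
    simp only [Nat.add_sub_cancel]
    push_cast
    linear_combination erlDiff ((N : ℤ) + 1) n t * this
  · have hs : Summable fun n : ℕ =>
        a * (coeffA N NR n a * (n * erlDiff ((N : ℤ) + 1) n t)
          + N * (coeffA N NR n a * erlDiff ((N : ℤ) + 1) n t)) := by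
      have hb : ∀ n, |erlDiff ((N : ℤ) + 1) n t| ≤ Real.exp (2 * |t|) * 2 ^ n := fun n =>
        (abs_erlDiff_le _ n t).trans_eq (mul_comm _ _)
      exact ((summable_coeffA_mul hNR a (natCast_mul_abs_le hb)).add
        ((summable_coeffA_mul hNR a hb).mul_left _)).mul_left _
    refine hs.congr fun n => ?_
    have := coeffA_succ hN hNR n a
    simp only [Nat.add_sub_cancel]
    push_cast
    linear_combination -erlDiff ((N : ℤ) + 1) n t * this

/-- The third-order differential equation in `t`. -/
theorem pdfSer_ode {N NR : ℕ} (hN : 1 ≤ N) (hNR : N ≤ NR) (t a : ℝ) :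
    t * (-2 * pdfSer N NR 1 t a + ((N : ℝ) - 3 - t) * pdfSer N NR 2 t a
        - t * pdfSer N NR 3 t a) =
      ((N : ℝ) - 1 - t) * (-pdfSer N NR 0 t a + ((N : ℝ) - 2 - t) * pdfSer N NR 1 t a
        - t * pdfSer N NR 2 t a)
      - ((NR : ℝ) - 1) * (t * pdfSer N NR 1 t a - ((N : ℝ) - 1 - t) * pdfSer N NR 0 t a)
      + a * (((N : ℝ) - 1) * pdfSer N NR 0 t a - t * pdfSer N NR 1 t a) := by
  have h0 := (summable_pdfSer hNR 0 t a).hasSum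
  have h1 := (summable_pdfSer hNR 1 t a).hasSum
  have k0 := hasSum_natCast_mul hNR 0 t a
  have k1 := hasSum_natCast_mul hNR 1 t a
  -- `hr` and `hl` express the two series of `pdfSer_contiguous` by derivatives of p. In `hl` the
  -- weight n + N_R - 1 is split: `k0`, `k1` supply n, and `h0`, `h1` supply N_R - 1.
  have hr := ((h0.mul_left ((N : ℝ) - 1)).sub (h1.mul_left t)).tsum_eq
  have hl := (((k1.mul_left t).sub (k0.mul_left ((N : ℝ) - 1 - t))).add
    (((h1.mul_left t).sub (h0.mul_left ((N : ℝ) - 1 - t))).mul_left ((NR : ℝ) - 1))).tsum_eq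
  have hc := pdfSer_contiguous hN hNR t a
  have m1 := fun n : ℕ => mul_erlDiff ((N : ℤ) - 1) (n + 1) t
  have m2 := fun n : ℕ => mul_erlDiff (N : ℤ) n t
  have m3 := fun n : ℕ => erlDiff_succ (N : ℤ) n t
  simp only [sub_add_cancel, Nat.add_sub_cancel, Int.cast_sub, Int.cast_natCast, Int.cast_one,
    Nat.cast_add, Nat.cast_one] at m1 m2
  rw [tsum_congr (g := fun n : ℕ => coeffA N NR n a * ((N + n) * erlDiff ((N : ℤ) + 1) n t))
    fun n => by
      simp only [pow_zero, pow_one, one_mul, Nat.cast_zero, sub_zero, add_zero, Nat.cast_one]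
      linear_combination coeffA N NR n a * (m1 n + (N + n : ℝ) * m3 n)] at hr
  rw [tsum_congr (g := fun n : ℕ =>
    coeffA N NR n a * ((n + NR - 1) * (n * erlDiff ((N : ℤ) + 1) (n - 1) t)))
    fun n => by
      simp only [pow_zero, pow_one, one_mul, Nat.cast_zero, sub_zero, add_zero, Nat.cast_one]
      linear_combination coeffA N NR n a * (n + NR - 1) * (m2 n - m1 n - (N + n : ℝ) * m3 n)] at hl
  rw [hl, hr] at hc
  simp only [pdfSer, Nat.cast_zero, Nat.cast_one] at hc ⊢
  linear_combination hc

/-! ### Non-negativity through beta mixtures -/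

/-- The mixed moment `E[U ^ i (1 - U) ^ r]` of a `Beta(N, NR - N)` variable `U`. -/
def betaMoment (N NR r i : ℕ) : ℝ :=
  (N.ascFactorial i : ℝ) * ((NR - N).ascFactorial r : ℝ) / (NR.ascFactorial (i + r) : ℝ)

theorem betaMoment_nonneg (N NR r i : ℕ) : 0 ≤ betaMoment N NR r i := by
  unfold betaMoment; positivity

/-- This is 1 = U + (1 - U) under the expectation. Being purely algebraic, it also covers `NR = N`,
where U is the constant 1. -/
theorem betaMoment_sub {N NR : ℕ} (hN : 1 ≤ N) (hNR : N ≤ NR) (r i : ℕ) :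
    betaMoment N NR r i - betaMoment N NR r (i + 1) = betaMoment N NR (r + 1) i := by
  have hpos : (NR.ascFactorial (i + r) : ℝ) ≠ 0 := by
    obtain ⟨M, rfl⟩ : ∃ M, NR = M + 1 := ⟨NR - 1, by omega⟩
    exact_mod_cast (Nat.ascFactorial_pos M _).ne'
  have hR : (NR : ℝ) + (i + r) ≠ 0 := by
    have : (1 : ℝ) ≤ NR := by exact_mod_cast hN.trans hNR
    positivity
  simp only [betaMoment, add_right_comm i 1 r, ← add_assoc i r 1, Nat.ascFactorial_succ,
    Nat.cast_mul, Nat.cast_add, Nat.cast_sub hNR]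
  field_simp
  ring

/-- `E[U ^ i (1 - U) ^ r (1 - U + U S) ^ j]` applied to `erl`, with `S` the index shift. -/
theorem sum_choose_betaMoment_nonneg {N NR : ℕ} (hN : 1 ≤ N) (hNR : N ≤ NR) {t : ℝ} (ht : 0 ≤ t)
    (j r i : ℕ) (M : ℤ) :
    0 ≤ ∑ n ∈ Finset.range (j + 1),
      (j.choose n : ℝ) * (betaMoment N NR r (i + n) * erlDiff M n t) := by
  induction j generalizing r i M with
  | zero =>
    simpa [erlDiff_zero] using mul_nonneg (betaMoment_nonneg N NR r i) (erl_nonneg M ht)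
  | succ j ih =>
    -- One factor 1 + UΔ is split as (1 - U) + US: the first part raises `r`, the second raises `i`
    -- and shifts `M`.
    refine (add_nonneg (ih (r + 1) i M) (ih r (i + 1) (M + 1))).trans_eq ?_
    rw [Finset.sum_range_succ' _ (j + 1)]
    simp only [Nat.choose_succ_succ, Nat.cast_add, add_mul, Finset.sum_add_distrib]
    rw [Finset.sum_range_succ (fun n => (j.choose (n + 1) : ℝ) * _) j]
    have h1 := Finset.sum_range_succ'
      (fun n => (j.choose n : ℝ) * (betaMoment N NR r (i + n) * erlDiff M n t)) j
    have h2 : ∑ n ∈ Finset.range (j + 1),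
          (j.choose n : ℝ) * (betaMoment N NR (r + 1) (i + n) * erlDiff M n t)
        + ∑ n ∈ Finset.range (j + 1),
          (j.choose n : ℝ) * (betaMoment N NR r (i + 1 + n) * erlDiff (M + 1) n t)
        = ∑ n ∈ Finset.range (j + 1),
          (j.choose n : ℝ) * (betaMoment N NR r (i + n) * erlDiff M n t)
        + ∑ n ∈ Finset.range (j + 1),
          (j.choose n : ℝ) * (betaMoment N NR r (i + (n + 1)) * erlDiff M (n + 1) t) := by
      rw [← Finset.sum_add_distrib, ← Finset.sum_add_distrib]
      refine Finset.sum_congr rfl fun n _ => ?_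
      rw [← betaMoment_sub hN hNR, erlDiff_succ, add_right_comm i 1 n, add_assoc i n 1]
      ring
    simp only [Nat.choose_zero_right, Nat.choose_succ_self, Nat.cast_zero, zero_mul,
      add_zero] at h1 ⊢
    linarith

/-- The differences alternate in sign, so the series is multiplied by e^a; the Cauchy product then
has the non-negative terms of `sum_choose_betaMoment_nonneg`. -/
theorem snrPdf_nonneg {N NR : ℕ} (hN : 1 ≤ N) (hNR : N ≤ NR) {t a : ℝ} (ht : 0 ≤ t) (ha : 0 ≤ a) :
    0 ≤ snrPdf N NR t a := by
  have hs := summable_pdfSer hNR 0 t a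
  have hprod := tsum_mul_tsum_eq_tsum_sum_antidiagonal_of_summable_norm hs.norm
    (Real.summable_pow_div_factorial a).norm
  have hexp : ∑' n : ℕ, a ^ n / (n ! : ℝ) = Real.exp a := by
    rw [Real.exp_eq_exp_ℝ, NormedSpace.exp_eq_tsum_div]
  rw [hexp] at hprod
  have hnn : 0 ≤ pdfSer N NR 0 t a * Real.exp a := by
    rw [pdfSer, hprod]
    refine tsum_nonneg fun j => ?_
    have h := mul_nonneg (div_nonneg (pow_nonneg ha j) (Nat.cast_nonneg (α := ℝ) j !))
      (sum_choose_betaMoment_nonneg hN hNR ht j 0 0 N)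
    rw [Finset.Nat.sum_antidiagonal_eq_sum_range_succ_mk, Finset.sum_congr rfl (fun n hn => ?_),
      ← Finset.mul_sum]
    · exact h
    · have hn' : n ≤ j := Nat.lt_succ_iff.mp (Finset.mem_range.mp hn)
      have hc : (j.choose n : ℝ) = (j ! : ℝ) / ((n ! : ℝ) * ((j - n)! : ℝ)) :=
        Nat.cast_choose ℝ hn'
      have hp : a ^ j = a ^ n * a ^ (j - n) := by rw [← pow_add, Nat.add_sub_cancel' hn']
      simp only [hc, hp, coeffA, betaMoment, Nat.ascFactorial_zero, zero_add, add_zero, pow_zero,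
        one_mul, Nat.cast_zero, sub_zero, Nat.cast_one, mul_one]
      field_simp
  rw [snrPdf_eq_pdfSer hN]
  exact nonneg_of_mul_nonneg_left hnn (Real.exp_pos a)

/-! ### The closed first-order system in `a` -/

/-- The `t`-derivative of the third-order differential equation. -/
theorem pdfSer_ode_deriv {N NR : ℕ} (hN : 1 ≤ N) (hNR : N ≤ NR) (t a : ℝ) :
    -2 * pdfSer N NR 1 t a + ((N : ℝ) - 3 - t) * pdfSer N NR 2 t a - t * pdfSer N NR 3 t a
      + t * (-3 * pdfSer N NR 2 t a + ((N : ℝ) - 4 - t) * pdfSer N NR 3 t a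
        - t * pdfSer N NR 4 t a) =
      -(-pdfSer N NR 0 t a + ((N : ℝ) - 2 - t) * pdfSer N NR 1 t a - t * pdfSer N NR 2 t a)
      + ((N : ℝ) - 1 - t) * (-2 * pdfSer N NR 1 t a + ((N : ℝ) - 3 - t) * pdfSer N NR 2 t a
        - t * pdfSer N NR 3 t a)
      - ((NR : ℝ) - 1) * (2 * pdfSer N NR 1 t a + t * pdfSer N NR 2 t a + pdfSer N NR 0 t a
        - ((N : ℝ) - 1 - t) * pdfSer N NR 1 t a - pdfSer N NR 1 t a)
      + a * (((N : ℝ) - 2) * pdfSer N NR 1 t a - t * pdfSer N NR 2 t a) := by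
  have d := fun l => hasDerivAt_pdfSer hNR l t a
  have hid := hasDerivAt_id' t
  have hc := fun c : ℝ => (hasDerivAt_const t c).sub hid
  have hL := hid.mul ((((d 1).const_mul (-2)).add ((hc ((N : ℝ) - 3)).mul (d 2))).sub
    (hid.mul (d 3)))
  have hR := (((hc ((N : ℝ) - 1)).mul (((d 0).neg.add ((hc ((N : ℝ) - 2)).mul (d 1))).sub
      (hid.mul (d 2)))).sub
    (((hid.mul (d 1)).sub ((hc ((N : ℝ) - 1)).mul (d 0))).const_mul ((NR : ℝ) - 1))).add
    ((((d 0).const_mul ((N : ℝ) - 1)).sub (hid.mul (d 1))).const_mul a)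
  have hLR := hL.unique (hR.congr_of_eventuallyEq
    (Filter.Eventually.of_forall fun τ => pdfSer_ode hN hNR τ a))
  simp only [Pi.add_apply, Pi.sub_apply, Pi.mul_apply, Pi.neg_apply, Nat.reduceAdd] at hLR
  linear_combination hLR

theorem hasDerivAt_snrVec {N NR : ℕ} (hN : 1 ≤ N) (hNR : N ≤ NR) {t a : ℝ} (ht : 0 < t)
    (ha : 0 < a) :
    HasDerivAt (fun b => snrVec N NR t b) ((1 / a) • (matQ N NR t a *ᵥ snrVec N NR t a)) a := by
  have h0 := hasDerivAt_pdfSer_param hNR 0 t ha.ne'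
  have h1 := hasDerivAt_pdfSer_param hNR 1 t ha.ne'
  have h2 := hasDerivAt_pdfSer_param hNR 2 t ha.ne'
  have o1 := pdfSer_ode hN hNR t a
  have o2 := pdfSer_ode_deriv hN hNR t a
  simp only [snrVec, snrPdf_eq_pdfSer hN, snrPdfDeriv_eq_pdfSer hN hNR]
  rw [hasDerivAt_pi]
  intro i
  fin_cases i
  · refine h0.congr_deriv ?_
    simp [matQ]
    left
    ring
  · refine h1.congr_deriv ?_
    simp [matQ]
    left
    field_simp
    linear_combination o1
  · refine h2.congr_deriv ?_
    simp [matQ]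
    left
    field_simp
    -- `t * o2` removes p⁽⁴⁾; what it leaves over is N - 2 - t times `o1`.
    linear_combination t * o2 + (N - 2 - t) * o1

/-! ### Laplace transforms and the moment generating function -/

theorem integral_exp_mul_erl {s : ℝ} (hs : s < 1) (k : ℕ) :
    ∫ t in Ioi 0, Real.exp (s * t) * erl ((k : ℤ) + 1) t = (1 / (1 - s)) ^ (k + 1) := by
  have hs' : 0 < 1 - s := by linarith
  have key := Real.integral_rpow_mul_exp_neg_mul_Ioi (a := (k : ℝ) + 1) (r := 1 - s)
    (by positivity) hs'
  rw [Real.Gamma_nat_eq_factorial, add_sub_cancel_right] at key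
  have e : ∀ t : ℝ, Real.exp (s * t) * erl ((k : ℤ) + 1) t =
      (t ^ (k : ℝ) * Real.exp (-((1 - s) * t))) * (1 / (k ! : ℝ)) := by
    intro t
    rw [erl_natCast_add_one, Real.rpow_natCast, show -((1 - s) * t) = s * t + -t by ring,
      Real.exp_add]
    ring
  simp only [e]
  rw [integral_mul_const, key]
  have : (1 / (1 - s)) ^ ((k : ℝ) + 1) = (1 / (1 - s)) ^ (k + 1) := by
    exact_mod_cast Real.rpow_natCast (1 / (1 - s)) (k + 1)
  rw [this]
  field_simp

theorem integrableOn_exp_mul_erl {s : ℝ} (hs : s < 1) (k : ℕ) :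
    IntegrableOn (fun t => Real.exp (s * t) * erl ((k : ℤ) + 1) t) (Ioi 0) := by
  have hs' : 0 < 1 - s := by linarith
  -- A non-integrable function has integral 0 by convention, so the positive value proves
  -- integrability.
  refine .of_integral_ne_zero ?_
  rw [integral_exp_mul_erl hs]
  positivity

theorem integrableOn_exp_mul_erlDiff {s : ℝ} (hs : s < 1) (k n : ℕ) :
    IntegrableOn (fun t => Real.exp (s * t) * erlDiff ((k : ℤ) + 1) n t) (Ioi 0) := by
  induction n generalizing k with
  | zero => exact integrableOn_exp_mul_erl hs k
  | succ n ih =>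
    simp only [erlDiff_succ, mul_sub]
    exact (by exact_mod_cast ih (k + 1) :
      IntegrableOn (fun t => Real.exp (s * t) * erlDiff ((k : ℤ) + 1 + 1) n t) (Ioi 0)).sub (ih k)

/-- Raising the index multiplies the transform by 1/(1-s), so each difference contributes 1/(1-s) -
1 = s/(1-s). -/
theorem integral_exp_mul_erlDiff {s : ℝ} (hs : s < 1) (k n : ℕ) :
    ∫ t in Ioi 0, Real.exp (s * t) * erlDiff ((k : ℤ) + 1) n t =
      (1 / (1 - s)) ^ (k + 1) * (s / (1 - s)) ^ n := by
  induction n generalizing k with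
  | zero => simpa [erlDiff_zero] using integral_exp_mul_erl hs k
  | succ n ih =>
    have i1 := integrableOn_exp_mul_erlDiff hs (k + 1) n
    have i2 := ih (k + 1)
    push_cast at i1 i2
    have hs' : 1 - s ≠ 0 := by linarith
    simp only [erlDiff_succ, mul_sub]
    rw [integral_sub i1 (integrableOn_exp_mul_erlDiff hs k n), ih k, i2]
    have e : s / (1 - s) = 1 / (1 - s) - 1 := by field_simp; ring
    rw [pow_succ (s / (1 - s)) n, pow_succ _ (k + 1)]
    linear_combination (-(1 / (1 - s)) ^ (k + 1) * (s / (1 - s)) ^ n) * e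

/-- The crude triangle inequality suffices: any geometric bound in `n` is absorbed by the factorial
in A_n. -/
theorem integral_norm_exp_mul_erlDiff_le {s : ℝ} (hs : s < 1) (k n : ℕ) :
    ∫ t in Ioi 0, ‖Real.exp (s * t) * erlDiff ((k : ℤ) + 1) n t‖ ≤
      (1 / (1 - s)) ^ (k + 1) * (1 / (1 - s) + 1) ^ n := by
  induction n generalizing k with
  | zero =>
    rw [pow_zero, mul_one, ← integral_exp_mul_erl hs k]
    refine (setIntegral_congr_fun measurableSet_Ioi fun t ht => ?_).le
    exact Real.norm_of_nonneg (mul_nonneg (Real.exp_nonneg _) (erl_nonneg _ (le_of_lt ht)))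
  | succ n ih =>
    have i1 := integrableOn_exp_mul_erlDiff hs (k + 1) n
    have i2 := ih (k + 1)
    have i3 := integrableOn_exp_mul_erlDiff hs k n
    push_cast at i1 i2
    simp only [erlDiff_succ, mul_sub]
    refine (integral_mono (i1.sub i3).norm (i1.norm.add i3.norm) fun t => norm_sub_le _ _).trans ?_
    rw [integral_add' i1.norm i3.norm]
    refine (add_le_add i2 (ih k)).trans_eq ?_
    ring

theorem summable_integral_norm_term {N NR : ℕ} (hN : 1 ≤ N) (hNR : N ≤ NR) (a : ℝ) {s : ℝ}
    (hs : s < 1) : Summable fun n =>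
      ∫ t in Ioi 0, ‖coeffA N NR n a * (Real.exp (s * t) * erlDiff N n t)‖ := by
  obtain ⟨k, rfl⟩ : ∃ k, N = k + 1 := ⟨N - 1, by omega⟩
  have hs' : 0 < 1 - s := by linarith
  have h := (summable_coeffA_mul hNR a (C := (1 / (1 - s)) ^ (k + 1)) (K := 1 / (1 - s) + 1)
    fun n => (abs_of_nonneg (by positivity)).le).abs
  refine Summable.of_nonneg_of_le (fun n => integral_nonneg fun t => norm_nonneg _) (fun n => ?_) h
  simp only [norm_mul (coeffA (k + 1) NR n a)]
  rw [integral_const_mul, abs_mul, Real.norm_eq_abs]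
  refine mul_le_mul_of_nonneg_left ?_ (abs_nonneg _)
  refine le_trans ?_ (le_abs_self _)
  exact_mod_cast integral_norm_exp_mul_erlDiff_le hs k n

theorem exp_mul_snrPdf {N NR : ℕ} (hN : 1 ≤ N) (s t a : ℝ) :
    Real.exp (s * t) * snrPdf N NR t a =
      ∑' n, coeffA N NR n a * (Real.exp (s * t) * erlDiff N n t) := by
  rw [snrPdf_eq_pdfSer hN, pdfSer, ← tsum_mul_left]
  refine tsum_congr fun n => ?_
  simp only [pow_zero, one_mul, Nat.cast_zero, sub_zero, add_zero]
  ring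

theorem integrable_term {N : ℕ} (hN : 1 ≤ N) (NR n : ℕ) (a : ℝ) {s : ℝ} (hs : s < 1) :
    IntegrableOn (fun t => coeffA N NR n a * (Real.exp (s * t) * erlDiff N n t)) (Ioi 0) := by
  obtain ⟨k, rfl⟩ : ∃ k, N = k + 1 := ⟨N - 1, by omega⟩
  exact_mod_cast (integrableOn_exp_mul_erlDiff hs k n).const_mul _

theorem integral_exp_mul_snrPdf {N NR : ℕ} (hN : 1 ≤ N) (hNR : N ≤ NR) (a : ℝ) {s : ℝ}
    (hs : s < 1) : ∫ t in Ioi 0, Real.exp (s * t) * snrPdf N NR t a = snrMgf N NR s a := by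
  simp only [exp_mul_snrPdf hN]
  rw [← integral_tsum_of_summable_integral_norm (fun n => integrable_term hN NR n a hs)
    (summable_integral_norm_term hN hNR a hs), snrMgf, hyp1F1, ← tsum_mul_left]
  refine tsum_congr fun n => ?_
  obtain ⟨k, rfl⟩ : ∃ k, N = k + 1 := ⟨N - 1, by omega⟩
  have h := integral_exp_mul_erlDiff hs k n
  rw [integral_const_mul]
  push_cast
  rw [h, coeffA, coeffA, mul_div_assoc, mul_pow, one_div_pow]
  ring

theorem integrable_tsum_of_summable_integral_norm {α : Type*} [MeasurableSpace α] {μ : Measure α}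
    {F : ℕ → α → ℝ} (hm : AEStronglyMeasurable (fun x => ∑' n, F n x) μ)
    (hF : ∀ n, Integrable (F n) μ) (hsum : Summable fun n => ∫ x, ‖F n x‖ ∂μ) :
    Integrable (fun x => ∑' n, F n x) μ := by
  refine ⟨hm, ?_⟩
  calc ∫⁻ x, ‖∑' n, F n x‖ₑ ∂μ ≤ ∫⁻ x, ∑' n, ‖F n x‖ₑ ∂μ :=
        lintegral_mono fun x => enorm_tsum_le_tsum_enorm
    _ = ∑' n, ∫⁻ x, ‖F n x‖ₑ ∂μ := lintegral_tsum fun n => (hF n).1.enorm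
    _ = ∑' n, ENNReal.ofReal (∫ x, ‖F n x‖ ∂μ) :=
        tsum_congr fun n => (ofReal_integral_norm_eq_lintegral_enorm (hF n)).symm
    _ < ⊤ := hsum.tsum_ofReal_lt_top

theorem integrableOn_exp_mul_snrPdf {N NR : ℕ} (hN : 1 ≤ N) (hNR : N ≤ NR) (a : ℝ) {s : ℝ}
    (hs : s < 1) : IntegrableOn (fun t => Real.exp (s * t) * snrPdf N NR t a) (Ioi 0) := by
  have hm : AEStronglyMeasurable (fun t => Real.exp (s * t) * snrPdf N NR t a)
      (volume.restrict (Ioi 0)) :=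
    ((by fun_prop : Continuous fun t : ℝ => Real.exp (s * t)).mul
      (contDiff_snrPdf hN hNR a).continuous).aestronglyMeasurable
  simp only [exp_mul_snrPdf hN] at hm ⊢
  exact integrable_tsum_of_summable_integral_norm hm (fun n => integrable_term hN NR n a hs)
    (summable_integral_norm_term hN hNR a hs)

theorem snrMgf_zero (N NR : ℕ) (a : ℝ) : snrMgf N NR 0 a = 1 := by
  rw [snrMgf, hyp1F1, tsum_eq_single 0 fun n hn => by simp [coeffA, hn]]
  simp [coeffA]

theorem hasSnrMgf_snrMeasure {N NR : ℕ} (hN : 1 ≤ N) (hNR : N ≤ NR) {a : ℝ} (ha : 0 ≤ a) :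
    HasSnrMgf N NR a (snrMeasure N NR a) := by
  have hm : Measurable fun t => ENNReal.ofReal (snrPdf N NR t a) :=
    (contDiff_snrPdf hN hNR a).continuous.measurable.ennreal_ofReal
  have hfin : ∀ᵐ t ∂(volume.restrict (Ioi (0 : ℝ))), ENNReal.ofReal (snrPdf N NR t a) < ⊤ :=
    Filter.Eventually.of_forall fun t => ENNReal.ofReal_lt_top
  have hpdf : ∀ t ∈ Ioi (0 : ℝ), (ENNReal.ofReal (snrPdf N NR t a)).toReal = snrPdf N NR t a :=
    fun t ht => ENNReal.toReal_ofReal (snrPdf_nonneg hN hNR (le_of_lt ht) ha)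
  have hint : ∀ s < 1, Integrable (fun x => Real.exp (s * x)) (snrMeasure N NR a) := by
    intro s hs
    rw [snrMeasure, integrable_withDensity_iff hm hfin]
    refine (integrableOn_exp_mul_snrPdf hN hNR a hs).congr_fun (fun t ht => ?_) measurableSet_Ioi
    rw [hpdf t ht]
  have hmgf : ∀ s < 1, ∫ x, Real.exp (s * x) ∂(snrMeasure N NR a) = snrMgf N NR s a := by
    intro s hs
    rw [snrMeasure, integral_withDensity_eq_integral_toReal_smul hm hfin,
      ← integral_exp_mul_snrPdf hN hNR a hs]
    refine setIntegral_congr_fun measurableSet_Ioi fun t ht => ?_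
    simp only [hpdf t ht, smul_eq_mul]
    ring
  refine ⟨?_, fun s hs => ⟨hint s hs, hmgf s hs⟩⟩
  -- At s = 0, integrability of the constant 1 gives finiteness, and the value of the integral gives
  -- mass 1.
  have h0 := hmgf 0 one_pos
  have i0 := hint 0 one_pos
  simp only [zero_mul, Real.exp_zero, snrMgf_zero, integral_const, smul_eq_mul, mul_one] at h0 i0
  have : IsFiniteMeasure (snrMeasure N NR a) := by
    simpa using integrable_const_iff.mp i0
  exact isProbabilityMeasure_iff_real.mpr h0

/-! ### Uniqueness of the law -/

/-- Two finite measures whose moment generating functions are finite and agree near `0` are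
equal. -/
theorem ext_of_mgf_eqOn_nhds_zero {μ ν : Measure ℝ} [IsFiniteMeasure μ] [IsFiniteMeasure ν]
    {c : ℝ} (hc : 0 < c) (hμ : ∀ s ∈ Ioo (-c) c, Integrable (fun x => Real.exp (s * x)) μ)
    (hν : ∀ s ∈ Ioo (-c) c, Integrable (fun x => Real.exp (s * x)) ν)
    (h : ∀ s ∈ Ioo (-c) c, mgf id μ s = mgf id ν s) : μ = ν := by
  set S : Set ℂ := {z | z.re ∈ Ioo (-c) c}
  have hμ' : Ioo (-c) c ⊆ interior (integrableExpSet id μ) := interior_maximal hμ isOpen_Ioo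
  have hν' : Ioo (-c) c ⊆ interior (integrableExpSet id ν) := interior_maximal hν isOpen_Ioo
  have haμ : AnalyticOnNhd ℂ (complexMGF id μ) S :=
    analyticOnNhd_complexMGF.mono fun z hz => hμ' hz
  have haν : AnalyticOnNhd ℂ (complexMGF id ν) S :=
    analyticOnNhd_complexMGF.mono fun z hz => hν' hz
  have h0 : (0 : ℝ) ∈ Ioo (-c) c := ⟨by linarith, hc⟩
  -- Identity theorem on a vertical strip: agreement on real points accumulating at 0 spreads to the
  -- imaginary axis, where the characteristic functions live.
  have heq : EqOn (complexMGF id μ) (complexMGF id ν) S := by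
    refine haμ.eqOn_of_preconnected_of_frequently_eq haν
      ((convex_Ioo (-c) c).linear_preimage Complex.reLm).isPreconnected
      (z₀ := ((0 : ℝ) : ℂ)) (by simpa [S] using hc) ?_
    have hreal : ∃ᶠ x : ℝ in nhdsWithin 0 {0}ᶜ, complexMGF id μ x = complexMGF id ν x := by
      refine Filter.Eventually.frequently ?_
      filter_upwards [mem_nhdsWithin_of_mem_nhds (isOpen_Ioo.mem_nhds h0)] with x hx
      rw [complexMGF_ofReal, complexMGF_ofReal, h x hx]
    refine Filter.Tendsto.frequently ?_ hreal
    refine tendsto_nhdsWithin_of_tendsto_nhds_of_eventually_within _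
      ((Complex.continuous_ofReal.tendsto 0).mono_left nhdsWithin_le_nhds) ?_
    filter_upwards [self_mem_nhdsWithin] with x hx
    simpa using hx
  refine Measure.ext_of_charFun (funext fun t => ?_)
  rw [← complexMGF_id_mul_I, ← complexMGF_id_mul_I]
  exact heq (by simpa [S] using hc)

theorem hasSnrMgf_iff {N NR : ℕ} (hN : 1 ≤ N) (hNR : N ≤ NR) {a : ℝ} (ha : 0 ≤ a)
    (ν : Measure ℝ) : HasSnrMgf N NR a ν ↔ ν = snrMeasure N NR a := by
  have hm := hasSnrMgf_snrMeasure hN hNR ha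
  refine ⟨fun h => ?_, fun h => h ▸ hm⟩
  have := h.1
  have := hm.1
  exact ext_of_mgf_eqOn_nhds_zero one_pos (fun s hs => (h.2 s hs.2).1)
    (fun s hs => (hm.2 s hs.2).1) fun s hs => (h.2 s hs.2).2.trans (hm.2 s hs.2).2.symm

end ZFSnr

end

theorem mainTheorem5 (N NR : ℕ) (hN : 1 ≤ N) (hNR : N ≤ NR) :
    -- `p(·, a)` is the density of the law whose moment generating function is `M(·, a)`
    (∀ a : ℝ, 0 ≤ a →
      (∀ t : ℝ, 0 < t → 0 ≤ ZFSnr.snrPdf N NR t a) ∧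
      ∀ ν : Measure ℝ, ZFSnr.HasSnrMgf N NR a ν ↔ ν = ZFSnr.snrMeasure N NR a) ∧
    -- `p(·, a)` is smooth on `(0, ∞)`
    (∀ a : ℝ, 0 ≤ a → ContDiffOn ℝ ∞ (fun t => ZFSnr.snrPdf N NR t a) (Ioi 0)) ∧
    -- the differential system with respect to `a`
    ∀ t a : ℝ, 0 < t → 0 < a →
      HasDerivAt (fun b => ZFSnr.snrVec N NR t b)
        ((1 / a) • (ZFSnr.matQ N NR t a *ᵥ ZFSnr.snrVec N NR t a)) a ∧
      a * deriv (fun b => ZFSnr.snrPdf N NR t b) a =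
        -ZFSnr.snrPdf N NR t a + ((N : ℝ) - t - 2) * ZFSnr.snrPdfDeriv N NR 1 t a
          - t * ZFSnr.snrPdfDeriv N NR 2 t a ∧
      a * deriv (fun b => ZFSnr.snrPdfDeriv N NR 1 t b) a =
        -t * ZFSnr.snrPdfDeriv N NR 3 t a + ((N : ℝ) - t - 3) * ZFSnr.snrPdfDeriv N NR 2 t a
          - 2 * ZFSnr.snrPdfDeriv N NR 1 t a := by
  refine ⟨fun a ha => ⟨fun t ht => ZFSnr.snrPdf_nonneg hN hNR ht.le ha,
    ZFSnr.hasSnrMgf_iff hN hNR ha⟩,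
    fun a _ => (ZFSnr.contDiff_snrPdf hN hNR a).contDiffOn, fun t a ht ha => ?_⟩
  have h0 := (ZFSnr.hasDerivAt_pdfSer_param hNR 0 t ha.ne').deriv
  have h1 := (ZFSnr.hasDerivAt_pdfSer_param hNR 1 t ha.ne').deriv
  refine ⟨ZFSnr.hasDerivAt_snrVec hN hNR ht ha, ?_, ?_⟩
  · simp only [ZFSnr.snrPdfDeriv_eq_pdfSer hN hNR, ZFSnr.snrPdf_eq_pdfSer hN]
    rw [h0]
    field_simp
    push_cast
    ring
  · simp only [ZFSnr.snrPdfDeriv_eq_pdfSer hN hNR]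
    rw [h1]
    field_simp
    push_cast
    ring
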